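/- Let $\mathcal K=L^2(\mathbb R^+)$ (complex-valued, scalar products linear in the second argument), let $\mathcal G$ be a complex Hilbert space with a fixed countably infinite orthonormal basis $(e_n)_{n\in\mathbb N}$, and let $\mathcal H=L^2(\mathbb R^+,\mathcal G)\cong\mathcal K\otimes\mathcal G$. Let $\Gamma(\mathcal H)$ be the symmetric Fock space over $\mathcal H$ with vacuum $\Omega$, where $v_1\circ\dots\circ v_n=\frac1{n!}\sum_{\pi\in S_n}v_{\pi(1)}\otimes\dots\otimes v_{\pi(n)}$, and let the finite particle domain $\Gamma_0(\mathcal H)$ be the linear span of $\Omega$ and of all vectors $v_1\circ\dots\circ v_n$ with $n\ge 1$, $v_1,\dots,v_n\in\mathcal H$. For $u\in\mathcal H$ let $a^*(u)$ and $a(u)$ be the boson creation and annihilation operators, $$a^*(u)(v_1\circ\dots\circ v_n)=\sqrt{n+1}\;u\circ v_1\circ\dots\circ v_n,\qquad a(u)(v_1\circ\dots\circ v_n)=\frac1{\sqrt n}\sum_{j=1}^n\langle u,v_j\rangle\, v_1\circ\dots\circ v_{j-1}\circ v_{j+1}\circ\dots\circ v_n,$$ with $a^*(u)\Omega=u$ and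 $a(u)\Omega=0$. For $\sigma\subseteq\mathbb N$ let $\Pi^{(\sigma)}$ be the orthogonal projection of $\mathcal H$ onto the closed subspace $\mathcal H^{(\sigma)}$ of the vectors $\sum_{k\in\sigma}u^{(k)}\otimes e_k$ with $u^{(k)}\in\mathcal K$ (so $\mathcal H^{(\emptyset)}=\{0\}$), and let $P^{(\sigma)}$ be its second quantization: $P^{(\sigma)}\Omega=\Omega$ and $P^{(\sigma)}(v_1\circ\dots\circ v_n)=\Pi^{(\sigma)}v_1\circ\dots\circ\Pi^{(\sigma)}v_n$. The filtered creation and annihilation operators are $$a^{(\sigma)*}(f\otimes e_k)=a^*(f\otimes e_k)P^{(\sigma)},\qquad a^{(\sigma)}(f\otimes e_k)=P^{(\sigma)}a(f\otimes e_k)\qquad(f\in\mathcal K,\ k\in\mathbb N).$$ All these operators leave $\Gamma_0(\mathcal H)$ invariant. Then for all $k,l\in\mathbb N$, all $\sigma,\tau\subseteq\mathbb N$ and all $f,g\in\mathcal K$, the following identity holds on $\Gamma_0(\mathcal H)$: $$a^{(\sigma)}(f\otimes e_k)\,a^{(\tau)*}(g\otimes e_l)-\mathbf 1_{\{l\in\sigma\}}\;a^{(\tau)*}(g\otimes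 e_l)\,a^{(\sigma)}(f\otimes e_k)\,P^{(\tau)}=\delta_{k,l}\,\langle f,g\rangle\,P^{(\sigma\cap\tau)}.$$ -/

import Mathlib

open scoped TensorProduct DirectSum

noncomputable section

universe u

namespace FilteredFock

section SymmetricTensors

variable (H : Type u) [NormedAddCommGroup H] [InnerProductSpace ℂ H]

/-- The algebraic tensor power `H ⊗ ⋯ ⊗ H` with `n` factors. -/
abbrev TPow (n : ℕ) : Type _ := PiTensorProduct ℂ (fun _ : Fin n => H)

variable {H}

/-- Permutation of the tensor factors:
`v₁ ⊗ ⋯ ⊗ vₙ ↦ v_{π(1)} ⊗ ⋯ ⊗ v_{π(n)}`. -/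
def permute {n : ℕ} (π : Equiv.Perm (Fin n)) : TPow H n →ₗ[ℂ] TPow H n :=
  PiTensorProduct.lift ((PiTensorProduct.tprod ℂ).domDomCongr π)

/-- The symmetrization map `(1 / n!) ∑_π π`. -/
def symmetrizer (n : ℕ) : TPow H n →ₗ[ℂ] TPow H n :=
  (n.factorial : ℂ)⁻¹ • ∑ π : Equiv.Perm (Fin n), permute π

/-- The symmetric product
`v₁ ∘ ⋯ ∘ vₙ = (1 / n!) ∑_π v_{π(1)} ⊗ ⋯ ⊗ v_{π(n)}`; for `n = 0` this is the vacuum `Ω`. -/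
def symProd {n : ℕ} (v : Fin n → H) : TPow H n :=
  (n.factorial : ℂ)⁻¹ • ∑ π : Equiv.Perm (Fin n), PiTensorProduct.tprod ℂ (fun i => v (π i))

variable (H) in
/-- The `n`-particle part of the finite particle domain: the linear span of the vectors
`v₁ ∘ ⋯ ∘ vₙ`. -/
def SymPow (n : ℕ) : Submodule ℂ (TPow H n) :=
  Submodule.span ℂ (Set.range (symProd : (Fin n → H) → TPow H n))

@[simp] lemma permute_tprod {n : ℕ} (π : Equiv.Perm (Fin n)) (v : Fin n → H) :
    permute π (PiTensorProduct.tprod ℂ v) = PiTensorProduct.tprod ℂ (fun i => v (π i)) := by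
  simp [permute]

lemma symmetrizer_tprod {n : ℕ} (v : Fin n → H) :
    symmetrizer n (PiTensorProduct.tprod ℂ v) = symProd v := by
  simp [symmetrizer, symProd]

lemma symProd_mem {n : ℕ} (v : Fin n → H) : symProd v ∈ SymPow H n :=
  Submodule.subset_span ⟨v, rfl⟩

lemma symmetrizer_mem {n : ℕ} (x : TPow H n) : symmetrizer n x ∈ SymPow H n := by
  induction x using PiTensorProduct.induction_on with
  | smul_tprod r v =>
    rw [map_smul, symmetrizer_tprod]
    exact Submodule.smul_mem _ _ (symProd_mem v)
  | add x y hx hy => rw [map_add]; exact Submodule.add_mem _ hx hy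

lemma symProd_perm {n : ℕ} (v : Fin n → H) (ρ : Equiv.Perm (Fin n)) :
    symProd (fun i => v (ρ i)) = symProd v := by
  unfold symProd
  congr 1
  exact Fintype.sum_equiv (Equiv.mulLeft ρ) _ _ (fun π => rfl)

lemma permute_symProd {n : ℕ} (v : Fin n → H) (ρ : Equiv.Perm (Fin n)) :
    permute ρ (symProd v) = symProd v := by
  simp only [symProd, map_smul, map_sum, permute_tprod]
  congr 1
  exact Fintype.sum_equiv (Equiv.mulRight ρ) _ _ (fun π => rfl)

lemma permute_eq_of_mem {n : ℕ} {x : TPow H n} (hx : x ∈ SymPow H n)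
    (ρ : Equiv.Perm (Fin n)) : permute ρ x = x := by
  induction hx using Submodule.span_induction with
  | mem x h => obtain ⟨v, rfl⟩ := h; exact permute_symProd v ρ
  | zero => simp
  | add x y _ _ hx hy => rw [map_add, hx, hy]
  | smul r x _ hx => rw [map_smul, hx]

lemma symmetrizer_eq_of_permute {n : ℕ} {x : TPow H n}
    (hx : ∀ ρ : Equiv.Perm (Fin n), permute ρ x = x) : symmetrizer n x = x := by
  have h : (n.factorial : ℂ) ≠ 0 := by exact_mod_cast n.factorial_ne_zero
  simp only [symmetrizer, LinearMap.smul_apply, LinearMap.sum_apply, hx, Finset.sum_const,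
    Finset.card_univ, Fintype.card_perm, Fintype.card_fin]
  rw [← Nat.cast_smul_eq_nsmul ℂ, smul_smul, inv_mul_cancel₀ h, one_smul]

lemma mem_of_permute {n : ℕ} {x : TPow H n}
    (hx : ∀ ρ : Equiv.Perm (Fin n), permute ρ x = x) : x ∈ SymPow H n := by
  rw [← symmetrizer_eq_of_permute hx]
  exact symmetrizer_mem x

/-- `v₁ ⊗ ⋯ ⊗ vₙ ↦ u ⊗ v₁ ⊗ ⋯ ⊗ vₙ`. -/
def insertFirst (u : H) (n : ℕ) : TPow H n →ₗ[ℂ] TPow H (n + 1) :=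
  PiTensorProduct.lift
    ((PiTensorProduct.tprod ℂ : MultilinearMap ℂ (fun _ : Fin (n + 1) => H) _).curryLeft u)

/-- `v₁ ⊗ v₂ ⊗ ⋯ ⊗ vₙ₊₁ ↦ ⟨u, v₁⟩ v₂ ⊗ ⋯ ⊗ vₙ₊₁`. -/
def contractFirst (u : H) (n : ℕ) : TPow H (n + 1) →ₗ[ℂ] TPow H n :=
  PiTensorProduct.lift
    (LinearMap.uncurryLeft ((innerₛₗ ℂ u).smulRight (PiTensorProduct.tprod ℂ)))

@[simp] lemma insertFirst_tprod (u : H) {n : ℕ} (v : Fin n → H) :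
    insertFirst u n (PiTensorProduct.tprod ℂ v) = PiTensorProduct.tprod ℂ (Fin.cons u v) := by
  simp [insertFirst]

@[simp] lemma contractFirst_tprod (u : H) {n : ℕ} (v : Fin (n + 1) → H) :
    contractFirst u n (PiTensorProduct.tprod ℂ v) =
      inner ℂ u (v 0) • PiTensorProduct.tprod ℂ (fun i => v i.succ) := by
  simp [contractFirst, Fin.tail_def]

/-- The permutation of `{0, …, n}` that fixes `0` and acts as `ρ` on the rest. -/
def extendPerm {n : ℕ} (ρ : Equiv.Perm (Fin n)) : Equiv.Perm (Fin (n + 1)) :=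
  Equiv.Perm.decomposeFin.symm (0, ρ)

@[simp] lemma extendPerm_zero {n : ℕ} (ρ : Equiv.Perm (Fin n)) : extendPerm ρ 0 = 0 :=
  Equiv.Perm.decomposeFin_symm_apply_zero 0 ρ

@[simp] lemma extendPerm_succ {n : ℕ} (ρ : Equiv.Perm (Fin n)) (i : Fin n) :
    extendPerm ρ i.succ = (ρ i).succ := by
  simp [extendPerm]

lemma permute_contractFirst_tprod (u : H) {n : ℕ} (ρ : Equiv.Perm (Fin n))
    (v : Fin (n + 1) → H) :
    permute ρ (contractFirst u n (PiTensorProduct.tprod ℂ v)) =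
      contractFirst u n (permute (extendPerm ρ) (PiTensorProduct.tprod ℂ v)) := by
  simp

lemma permute_contractFirst (u : H) {n : ℕ} (ρ : Equiv.Perm (Fin n)) (x : TPow H (n + 1)) :
    permute ρ (contractFirst u n x) = contractFirst u n (permute (extendPerm ρ) x) := by
  induction x using PiTensorProduct.induction_on with
  | smul_tprod r v => simp only [map_smul, permute_contractFirst_tprod]
  | add x y hx hy => simp only [map_add, hx, hy]

lemma contractFirst_mem (u : H) {n : ℕ} {x : TPow H (n + 1)} (hx : x ∈ SymPow H (n + 1)) :
    contractFirst u n x ∈ SymPow H n := by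
  refine mem_of_permute fun ρ => ?_
  rw [permute_contractFirst, permute_eq_of_mem hx]

lemma permute_map (T : H →ₗ[ℂ] H) {n : ℕ} (ρ : Equiv.Perm (Fin n)) (x : TPow H n) :
    permute ρ (PiTensorProduct.map (fun _ => T) x) =
      PiTensorProduct.map (fun _ => T) (permute ρ x) := by
  induction x using PiTensorProduct.induction_on with
  | smul_tprod r v => simp
  | add x y hx hy => simp only [map_add, hx, hy]

lemma map_mem (T : H →ₗ[ℂ] H) {n : ℕ} {x : TPow H n} (hx : x ∈ SymPow H n) :
    PiTensorProduct.map (fun _ => T) x ∈ SymPow H n := by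
  refine mem_of_permute fun ρ => ?_
  rw [permute_map, permute_eq_of_mem hx]

variable (H) in
/-- The finite particle domain `Γ₀(H)` of the symmetric Fock space `Γ(H)`: the linear span of
the vacuum and of the vectors `v₁ ∘ ⋯ ∘ vₙ`, that is, the algebraic direct sum of the spaces
`SymPow H n`. With the scalar product constructed below it is an inner product space, whose
completion is `Γ(H)`. -/
def FiniteParticle : Type _ := ⨁ n : ℕ, SymPow H n

instance : AddCommGroup (FiniteParticle H) := inferInstanceAs (AddCommGroup (⨁ n, SymPow H n))

instance : Module ℂ (FiniteParticle H) := inferInstanceAs (Module ℂ (⨁ n, SymPow H n))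

/-- The inclusion of the `n`-particle vectors into `Γ₀(H)`. -/
def incl (n : ℕ) : SymPow H n →ₗ[ℂ] FiniteParticle H :=
  DirectSum.lof ℂ ℕ (fun n => SymPow H n) n

/-- The linear map on `Γ₀(H)` with given restrictions to the `n`-particle vectors. -/
def glue {E : Type*} [AddCommGroup E] [Module ℂ E] (T : ∀ n, SymPow H n →ₗ[ℂ] E) :
    FiniteParticle H →ₗ[ℂ] E :=
  DirectSum.toModule ℂ ℕ E T

@[simp] lemma glue_incl {E : Type*} [AddCommGroup E] [Module ℂ E]
    (T : ∀ n, SymPow H n →ₗ[ℂ] E) (n : ℕ) (x : SymPow H n) : glue T (incl n x) = T n x :=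
  DirectSum.toModule_lof (M := fun n => SymPow H n) ℂ (φ := T) n x

/-- The vector `v₁ ∘ ⋯ ∘ vₙ` of `Γ₀(H)`; the vacuum `Ω` for `n = 0`. -/
def symVec {n : ℕ} (v : Fin n → H) : FiniteParticle H := incl n ⟨symProd v, symProd_mem v⟩

/-- The boson creation operator `a*(u)` on `Γ₀(H)`: on the `n`-particle vectors it is
`√(n + 1)` times the symmetrization of `x ↦ u ⊗ x`, so that
`a*(u) (v₁ ∘ ⋯ ∘ vₙ) = √(n + 1) u ∘ v₁ ∘ ⋯ ∘ vₙ`. -/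
def creation (u : H) : FiniteParticle H →ₗ[ℂ] FiniteParticle H :=
  glue fun n => ((Real.sqrt (n + 1) : ℝ) : ℂ) •
    (incl (n + 1) ∘ₗ
      (symmetrizer (n + 1) ∘ₗ insertFirst u n).restrict (fun _ _ => symmetrizer_mem _))

/-- The boson annihilation operator `a(u)` on `Γ₀(H)`: it kills the vacuum, and on the
`(n + 1)`-particle vectors it is `√(n + 1)` times the contraction of one tensor factor with `u`,
so that `a(u) (v₁ ∘ ⋯ ∘ vₙ) = (1 / √n) ∑ⱼ ⟨u, vⱼ⟩ v₁ ∘ ⋯ (omit vⱼ) ⋯ ∘ vₙ`. -/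
def annihilation (u : H) : FiniteParticle H →ₗ[ℂ] FiniteParticle H :=
  glue fun
    | 0 => 0
    | n + 1 => ((Real.sqrt (n + 1) : ℝ) : ℂ) •
        (incl n ∘ₗ (contractFirst u n).restrict (fun _ hx => contractFirst_mem u hx))

/-- The second quantization of `T`, acting on `Γ₀(H)` by
`v₁ ∘ ⋯ ∘ vₙ ↦ T v₁ ∘ ⋯ ∘ T vₙ` and fixing the vacuum. -/
def secondQuantization (T : H →L[ℂ] H) : FiniteParticle H →ₗ[ℂ] FiniteParticle H :=
  glue fun n => incl n ∘ₗ
    (PiTensorProduct.map (fun _ : Fin n => (T : H →ₗ[ℂ] H))).restrict (fun _ hx => map_mem _ hx)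

lemma symmetrizer_insertFirst_permute (u : H) {n : ℕ} (ρ : Equiv.Perm (Fin n)) (v : Fin n → H) :
    symmetrizer (n + 1) (insertFirst u n (PiTensorProduct.tprod ℂ fun i => v (ρ i))) =
      symProd (Fin.cons u v : Fin (n + 1) → H) := by
  rw [insertFirst_tprod, symmetrizer_tprod, ← symProd_perm (Fin.cons u v) (extendPerm ρ)]
  congr 1
  funext i
  refine Fin.cases ?_ (fun j => ?_) i <;> simp

lemma creation_symVec (u : H) {n : ℕ} (v : Fin n → H) :
    creation u (symVec v) =
      ((Real.sqrt (n + 1) : ℝ) : ℂ) • symVec (Fin.cons u v : Fin (n + 1) → H) := by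
  have h : (n.factorial : ℂ) ≠ 0 := by exact_mod_cast n.factorial_ne_zero
  simp only [creation, symVec, glue_incl, LinearMap.comp_apply, LinearMap.smul_apply]
  congr 2
  ext
  rw [LinearMap.coe_restrict_apply]
  simp only [LinearMap.comp_apply]
  conv_lhs => rw [symProd]
  simp only [map_smul, map_sum, symmetrizer_insertFirst_permute, Finset.sum_const,
    Finset.card_univ, Fintype.card_perm, Fintype.card_fin]
  rw [← Nat.cast_smul_eq_nsmul ℂ, smul_smul, inv_mul_cancel₀ h, one_smul]

lemma annihilation_vacuum (u : H) (v : Fin 0 → H) : annihilation u (symVec v) = 0 := by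
  simp [annihilation, symVec]

lemma contractFirst_symProd (u : H) {n : ℕ} (v : Fin (n + 1) → H) :
    contractFirst u n (symProd v) =
      ((n + 1 : ℕ) : ℂ)⁻¹ • ∑ j, inner ℂ u (v j) • symProd (fun i => v (j.succAbove i)) := by
  have hs : ∀ j : Fin (n + 1),
      symProd (fun i : Fin n => v (Equiv.swap 0 j i.succ)) =
        symProd (fun i => v (j.succAbove i)) := by
    intro j
    have hne : ∀ i : Fin n, Equiv.swap 0 j i.succ ≠ j := fun i h => by
      have := (Equiv.swap (0 : Fin (n + 1)) j).injective (h.trans (Equiv.swap_apply_left 0 j).symm)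
      exact Fin.succ_ne_zero i this
    choose θ hθ using fun i => Fin.exists_succAbove_eq (hne i)
    have hinj : Function.Injective θ := fun a b hab => by
      have : Equiv.swap 0 j a.succ = Equiv.swap 0 j b.succ := by rw [← hθ a, ← hθ b, hab]
      exact Fin.succ_injective _ ((Equiv.swap 0 j).injective this)
    have := symProd_perm (fun i => v (j.succAbove i))
      (Equiv.ofBijective θ (Finite.injective_iff_bijective.mp hinj))
    rw [← this]
    simp [hθ]
  rw [symProd, map_smul, map_sum]
  rw [← Fintype.sum_equiv Equiv.Perm.decomposeFin.symm
    (fun p : Fin (n + 1) × Equiv.Perm (Fin n) => inner ℂ u (v p.1) •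
      PiTensorProduct.tprod ℂ (fun i => v (Equiv.swap 0 p.1 (p.2 i).succ))) _ ?_]
  · rw [Fintype.sum_prod_type, Nat.factorial_succ, Nat.cast_mul, mul_inv, mul_smul,
      Finset.smul_sum]
    congr 1
    refine Finset.sum_congr rfl fun j _ => ?_
    rw [← hs j, symProd, smul_comm]
    exact congrArg _ (Finset.smul_sum (r := (inner ℂ u (v j) : ℂ))).symm
  · rintro ⟨j, π⟩
    simp [Equiv.Perm.decomposeFin_symm_apply_succ]

lemma annihilation_symVec (u : H) {n : ℕ} (v : Fin (n + 1) → H) :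
    annihilation u (symVec v) = ((Real.sqrt (n + 1) : ℝ) : ℂ)⁻¹ •
      ∑ j, inner ℂ u (v j) • symVec (fun i => v (j.succAbove i)) := by
  have h0 : ((Real.sqrt (n + 1) : ℝ) : ℂ) ≠ 0 := by
    exact_mod_cast (Real.sqrt_pos.mpr (by positivity)).ne'
  have h1 : ((Real.sqrt (n + 1) : ℝ) : ℂ) * ((Real.sqrt (n + 1) : ℝ) : ℂ) = ((n + 1 : ℕ) : ℂ) := by
    rw [← Complex.ofReal_mul, Real.mul_self_sqrt (by positivity)]
    push_cast
    rfl
  have h2 : (contractFirst u n).restrict (fun _ hx => contractFirst_mem u hx)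
      ⟨symProd v, symProd_mem v⟩ = ((n + 1 : ℕ) : ℂ)⁻¹ • ∑ j, inner ℂ u (v j) •
        (⟨_, symProd_mem (fun i => v (j.succAbove i))⟩ : SymPow H n) := by
    ext
    rw [LinearMap.coe_restrict_apply]
    simp [contractFirst_symProd]
  simp only [annihilation, symVec, glue_incl, LinearMap.comp_apply, LinearMap.smul_apply]
  rw [h2, map_smul, map_sum, smul_smul]
  simp only [map_smul]
  congr 1
  rw [← h1, mul_inv, ← mul_assoc, mul_inv_cancel₀ h0, one_mul]

lemma secondQuantization_symVec (T : H →L[ℂ] H) {n : ℕ} (v : Fin n → H) :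
    secondQuantization T (symVec v) = symVec (fun i => T (v i)) := by
  simp only [secondQuantization, symVec, glue_incl, LinearMap.comp_apply]
  congr 1
  ext
  simp [symProd]


section ScalarProduct

/-! The scalar product of the symmetric Fock space, with
`⟨v₁ ∘ ⋯ ∘ vₙ, w₁ ∘ ⋯ ∘ wₙ⟩ = (1 / n!) ∑_π ⟨v₁, w_{π(1)}⟩ ⋯ ⟨vₙ, w_{π(n)}⟩`, and the fact that
`a(u)` is the adjoint of `a*(u)` for it. -/

/-- The identification `v₁ ⊗ v₂ ⊗ ⋯ ↦ v₁ ⊗ (v₂ ⊗ ⋯)`. -/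
def splitFirst (n : ℕ) : TPow H (n + 1) ≃ₗ[ℂ] H ⊗[ℂ] TPow H n :=
  PiTensorProduct.reindex ℂ (fun _ => H)
      ((finSuccEquiv n).trans ((Equiv.optionEquivSumPUnit (Fin n)).trans (Equiv.sumComm _ _))) ≪≫ₗ
    (PiTensorProduct.tmulEquiv ℂ H).symm ≪≫ₗ
    TensorProduct.congr (PiTensorProduct.subsingletonEquiv (s := fun _ : PUnit.{1} => H) PUnit.unit)
      (LinearEquiv.refl ℂ (TPow H n))

lemma splitFirst_tprod {n : ℕ} (v : Fin (n + 1) → H) :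
    splitFirst n (PiTensorProduct.tprod ℂ v) =
      v 0 ⊗ₜ[ℂ] PiTensorProduct.tprod ℂ (fun i => v i.succ) := by
  simp [splitFirst]

/-- A bundled complex inner product space. -/
structure PreHilb : Type (u + 1) where
  carrier : Type u
  [grp : NormedAddCommGroup carrier]
  [ips : InnerProductSpace ℂ carrier]

attribute [instance] PreHilb.grp PreHilb.ips

variable (H) in
/-- The iterated tensor product `H ⊗ (H ⊗ (⋯ ⊗ ℂ))` of inner product spaces, whose scalar product
is the product of the scalar products of the factors. -/
def IterTensor : ℕ → PreHilb.{u}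
  | 0 => ⟨EuclideanSpace ℂ PUnit.{u + 1}⟩
  | n + 1 => ⟨H ⊗[ℂ] (IterTensor n).carrier⟩

/-- The identification `v₁ ⊗ ⋯ ⊗ vₙ ↦ v₁ ⊗ (v₂ ⊗ (⋯ ⊗ 1))`. -/
def toIter : ∀ n : ℕ, TPow H n ≃ₗ[ℂ] (IterTensor H n).carrier
  | 0 => PiTensorProduct.isEmptyEquiv (Fin 0) ≪≫ₗ
      (LinearEquiv.funUnique PUnit.{u + 1} ℂ ℂ).symm ≪≫ₗ
      (WithLp.linearEquiv 2 ℂ (PUnit.{u + 1} → ℂ)).symm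
  | n + 1 => splitFirst n ≪≫ₗ TensorProduct.congr (LinearEquiv.refl ℂ H) (toIter n)

lemma inner_toIter : ∀ {n : ℕ} (v w : Fin n → H),
    inner ℂ (toIter n (PiTensorProduct.tprod ℂ v)) (toIter n (PiTensorProduct.tprod ℂ w)) =
      ∏ i, inner ℂ (v i) (w i)
  | 0, v, w => by
    have h : ∀ v : Fin 0 → H, toIter 0 (PiTensorProduct.tprod ℂ v) =
        (WithLp.toLp 2 (fun _ => 1) : EuclideanSpace ℂ PUnit.{u + 1}) := fun v => by
      have h1 : toIter 0 (PiTensorProduct.tprod ℂ v) =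
        (WithLp.toLp 2 (fun _ => PiTensorProduct.isEmptyEquiv (Fin 0)
          (PiTensorProduct.tprod ℂ v)) : EuclideanSpace ℂ PUnit.{u + 1}) := rfl
      exact h1.trans (congrArg (fun c => (WithLp.toLp 2 (fun _ => c) : EuclideanSpace ℂ PUnit))
        (PiTensorProduct.isEmptyEquiv_apply_tprod (Fin 0) v))
    rw [h, h]
    refine (PiLp.inner_apply (𝕜 := ℂ) (f := fun _ : PUnit.{u + 1} => ℂ) _ _).trans ?_
    simp
  | n + 1, v, w => by
    rw [Fin.prod_univ_succ, ← inner_toIter (fun i => v i.succ) (fun i => w i.succ)]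
    have h : ∀ v : Fin (n + 1) → H, toIter (n + 1) (PiTensorProduct.tprod ℂ v) =
        (v 0 ⊗ₜ[ℂ] toIter n (PiTensorProduct.tprod ℂ fun i => v i.succ) :
          H ⊗[ℂ] (IterTensor H n).carrier) := fun v => by
      have h1 : toIter (n + 1) (PiTensorProduct.tprod ℂ v) =
        (TensorProduct.congr (LinearEquiv.refl ℂ H) (toIter n)
          (splitFirst n (PiTensorProduct.tprod ℂ v)) :
          H ⊗[ℂ] (IterTensor H n).carrier) := rfl
      rw [h1, splitFirst_tprod]
      rfl
    rw [h, h]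
    exact TensorProduct.inner_tmul ℂ _ _ _ _

/-- The scalar product on `TPow H n`, with
`⟨v₁ ⊗ ⋯ ⊗ vₙ, w₁ ⊗ ⋯ ⊗ wₙ⟩ = ⟨v₁, w₁⟩ ⋯ ⟨vₙ, wₙ⟩`. -/
def innerT {n : ℕ} (x y : TPow H n) : ℂ := inner ℂ (toIter n x) (toIter n y)

lemma innerT_tprod {n : ℕ} (v w : Fin n → H) :
    innerT (PiTensorProduct.tprod ℂ v) (PiTensorProduct.tprod ℂ w) = ∏ i, inner ℂ (v i) (w i) :=
  inner_toIter v w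


/-- The `n`-particle component of a vector of `Γ₀(H)`. -/
def comp (n : ℕ) : FiniteParticle H →ₗ[ℂ] SymPow H n :=
  DirectSum.component ℂ ℕ (fun n => SymPow H n) n

lemma finite_comp (x : FiniteParticle H) : {n | comp n x ≠ 0}.Finite := by
  classical
  exact (DFinsupp.finite_support (β := fun n => SymPow H n) x)

lemma induction_incl {p : FiniteParticle H → Prop} (h0 : p 0)
    (h1 : ∀ n (x : SymPow H n), p (incl n x)) (h2 : ∀ x y, p x → p y → p (x + y))
    (x : FiniteParticle H) : p x := by
  classical
  exact DirectSum.induction_on (β := fun n => SymPow H n) x h0 h1 h2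

lemma ext_comp {x y : FiniteParticle H} (h : ∀ n, comp n x = comp n y) : x = y :=
  DFinsupp.ext (β := fun n => SymPow H n) h

@[simp] lemma comp_incl_self (n : ℕ) (x : SymPow H n) : comp n (incl n x) = x :=
  DirectSum.component.lof_self ℂ (M := fun n => SymPow H n) n x

lemma comp_incl_ne {m n : ℕ} (h : m ≠ n) (x : SymPow H m) : comp n (incl m x) = 0 :=
  (DirectSum.component.of ℂ (M := fun n => SymPow H n) n m x).trans (dif_neg h)

/-- `Γ₀(H)` as a subspace of the Hilbert sum of the tensor powers of `H`. -/
def toHilbertSum : FiniteParticle H →ₗ[ℂ] lp (fun n => (IterTensor H n).carrier) 2 where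
  toFun x := ⟨fun n => toIter n (comp n x), by
    refine (memℓp_zero ?_).of_exponent_ge zero_le
    refine (finite_comp x).subset fun n hn => ?_
    intro h
    apply hn
    simp [h]⟩
  map_add' x y := by
    ext n
    exact (congrArg (toIter n) (by simp)).trans (map_add (toIter n) _ _)
  map_smul' r x := by
    ext n
    exact (congrArg (toIter n) (by simp)).trans (map_smul (toIter n) r _)

lemma toHilbertSum_injective : Function.Injective (toHilbertSum (H := H)) := by
  intro x y h
  refine ext_comp fun n => ?_
  have := congrFun (congrArg Subtype.val h) n
  exact Subtype.ext ((toIter n).injective this)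

/-- The scalar product of the symmetric Fock space: distinct particle numbers are orthogonal, and
on the `n`-particle vectors it is the scalar product of the tensor power. -/
@[reducible] def fockCore : InnerProductSpace.Core ℂ (FiniteParticle H) where
  inner x y := inner ℂ (toHilbertSum x) (toHilbertSum y)
  conj_inner_symm _ _ := inner_conj_symm _ _
  re_inner_nonneg _ := inner_self_nonneg
  add_left _ _ _ := by rw [map_add, inner_add_left]
  smul_left _ _ _ := by rw [map_smul, inner_smul_left]
  definite x h := toHilbertSum_injective (by rw [inner_self_eq_zero.mp h, map_zero])

instance : NormedAddCommGroup (FiniteParticle H) := fockCore.toNormedAddCommGroup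

instance : InnerProductSpace ℂ (FiniteParticle H) := .ofCore fockCore.toCore

lemma inner_eq_tsum (x y : FiniteParticle H) :
    inner ℂ x y = ∑' n, innerT (comp n x : TPow H n) (comp n y : TPow H n) :=
  lp.inner_eq_tsum _ _

lemma innerT_add_left {n : ℕ} (x y z : TPow H n) :
    innerT (x + y) z = innerT x z + innerT y z := by
  rw [innerT, map_add, inner_add_left]; rfl

lemma innerT_add_right {n : ℕ} (x y z : TPow H n) :
    innerT x (y + z) = innerT x y + innerT x z := by
  rw [innerT, map_add, inner_add_right]; rfl

lemma innerT_smul_left {n : ℕ} (r : ℂ) (x y : TPow H n) :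
    innerT (r • x) y = (starRingEnd ℂ) r * innerT x y := by
  rw [innerT, map_smul, inner_smul_left]; rfl

lemma innerT_smul_right {n : ℕ} (r : ℂ) (x y : TPow H n) :
    innerT x (r • y) = r * innerT x y := by
  rw [innerT, map_smul, inner_smul_right]; rfl

lemma innerT_sum_left {n : ℕ} {ι : Type*} (s : Finset ι) (x : ι → TPow H n) (y : TPow H n) :
    innerT (∑ i ∈ s, x i) y = ∑ i ∈ s, innerT (x i) y := by
  rw [innerT, map_sum, sum_inner]; rfl

lemma innerT_sum_right {n : ℕ} {ι : Type*} (s : Finset ι) (x : TPow H n) (y : ι → TPow H n) :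
    innerT x (∑ i ∈ s, y i) = ∑ i ∈ s, innerT x (y i) := by
  rw [innerT, map_sum, inner_sum]; rfl

lemma innerT_permute {n : ℕ} (π : Equiv.Perm (Fin n)) (x y : TPow H n) :
    innerT (permute π x) (permute π y) = innerT x y := by
  induction x using PiTensorProduct.induction_on with
  | smul_tprod r v =>
    induction y using PiTensorProduct.induction_on with
    | smul_tprod c w =>
      simp only [map_smul, innerT_smul_left, innerT_smul_right, permute_tprod, innerT_tprod]
      congr 2
      exact Equiv.prod_comp π (fun i => (inner ℂ (v i) (w i) : ℂ))
    | add y z hy hz => simp only [map_add, innerT_add_right, hy, hz]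
  | add x z hx hz => simp only [map_add, innerT_add_left, hx, hz]

lemma innerT_symmetrizer {n : ℕ} (x : TPow H n) {y : TPow H n} (hy : y ∈ SymPow H n) :
    innerT (symmetrizer n x) y = innerT x y := by
  have h : (n.factorial : ℂ) ≠ 0 := by exact_mod_cast n.factorial_ne_zero
  have hp : ∀ π, innerT (permute π x) y = innerT x y := fun π => by
    conv_lhs => rw [← permute_eq_of_mem hy π, innerT_permute]
  simp only [symmetrizer, LinearMap.smul_apply, LinearMap.sum_apply, innerT_smul_left,
    innerT_sum_left, hp, Finset.sum_const, Finset.card_univ, Fintype.card_perm, Fintype.card_fin]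
  rw [nsmul_eq_mul, map_inv₀, map_natCast, inv_mul_cancel_left₀ h]

lemma innerT_insertFirst (u : H) {n : ℕ} (x : TPow H n) (y : TPow H (n + 1)) :
    innerT (insertFirst u n x) y = innerT x (contractFirst u n y) := by
  induction x using PiTensorProduct.induction_on with
  | smul_tprod r v =>
    induction y using PiTensorProduct.induction_on with
    | smul_tprod c w =>
      simp only [map_smul, innerT_smul_left, innerT_smul_right, insertFirst_tprod,
        contractFirst_tprod, innerT_tprod, Fin.prod_univ_succ, Fin.cons_zero, Fin.cons_succ]
      ring
    | add y z hy hz => simp only [map_add, innerT_add_right, hy, hz]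
  | add x z hx hz => simp only [map_add, innerT_add_left, hx, hz]

lemma inner_incl {n : ℕ} (x : SymPow H n) (y : FiniteParticle H) :
    inner ℂ (incl n x) y = innerT (x : TPow H n) (comp n y : TPow H n) := by
  rw [inner_eq_tsum, tsum_eq_single n, comp_incl_self]
  intro m hm
  rw [comp_incl_ne hm.symm]
  simp [innerT]

lemma inner_symVec {n : ℕ} (v w : Fin n → H) :
    inner ℂ (symVec v) (symVec w) =
      (n.factorial : ℂ)⁻¹ * ∑ π : Equiv.Perm (Fin n), ∏ i, inner ℂ (v i) (w (π i)) := by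
  rw [symVec, symVec, inner_incl, comp_incl_self]
  change innerT (symProd v) (symProd w) = _
  rw [← symmetrizer_tprod v, innerT_symmetrizer _ (symProd_mem w), symProd, innerT_smul_right,
    innerT_sum_right]
  simp only [innerT_tprod]

lemma inner_symVec_of_ne {m n : ℕ} (h : m ≠ n) (v : Fin m → H) (w : Fin n → H) :
    inner ℂ (symVec v) (symVec w) = (0 : ℂ) := by
  rw [symVec, symVec, inner_incl, comp_incl_ne h.symm]
  simp [innerT]

lemma comp_annihilation (u : H) (n : ℕ) (y : FiniteParticle H) :
    (comp n (annihilation u y) : TPow H n) =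
      ((Real.sqrt (n + 1) : ℝ) : ℂ) • contractFirst u n (comp (n + 1) y : TPow H (n + 1)) := by
  induction y using induction_incl with
  | h0 => simp only [map_zero, ZeroMemClass.coe_zero, smul_zero]
  | h1 m y =>
    cases m with
    | zero =>
      rw [comp_incl_ne (Nat.succ_ne_zero n).symm]
      simp [annihilation]
    | succ m =>
      simp only [annihilation, glue_incl, LinearMap.smul_apply, LinearMap.comp_apply, map_smul]
      by_cases h : m = n
      · subst h
        rw [comp_incl_self, comp_incl_self]
        rfl
      · rw [comp_incl_ne h, comp_incl_ne (by omega)]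
        simp
  | h2 y z hy hz => simp only [map_add, Submodule.coe_add, hy, hz, smul_add]

/-- `a(u)` is the adjoint of `a*(u)` with respect to the scalar product of the Fock space. -/
lemma inner_creation (u : H) (x y : FiniteParticle H) :
    (inner ℂ (creation u x) y : ℂ) = inner ℂ x (annihilation u y) := by
  induction x using induction_incl with
  | h0 => simp
  | h1 n x =>
    rw [inner_incl, comp_annihilation, innerT_smul_right, ← innerT_insertFirst]
    simp only [creation, glue_incl, LinearMap.smul_apply, LinearMap.comp_apply]
    rw [inner_smul_left, inner_incl, Complex.conj_ofReal, LinearMap.coe_restrict_apply,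
      LinearMap.comp_apply, innerT_symmetrizer _ (comp (n + 1) y).2]
  | h2 x z hx hz => rw [map_add, inner_add_left, inner_add_left, hx, hz]

end ScalarProduct
end SymmetricTensors

section Colors

open MeasureTheory

/-- Lebesgue measure on the half line `ℝ⁺ = [0, ∞)`. -/
abbrev halfLine : Measure ℝ := volume.restrict (Set.Ici 0)

/-- `L²(ℝ⁺)`. -/
abbrev K : Type := Lp ℂ 2 halfLine

/-- `L²(ℝ⁺, G)`, which is `L²(ℝ⁺) ⊗ G`. -/
abbrev L2 (G : Type*) [NormedAddCommGroup G] : Type _ := Lp G 2 halfLine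

variable {G : Type*} [NormedAddCommGroup G] [InnerProductSpace ℂ G]

/-- The vector `f ⊗ z` of `L²(ℝ⁺, G)`, that is, the function `t ↦ f(t) z`. -/
def tens (f : K) (z : G) : L2 G :=
  (ContinuousLinearMap.toSpanSingleton ℂ z).compLp f

variable [CompleteSpace G] (e : HilbertBasis ℕ ℂ G)

/-- The closed subspace `H^(σ)` of the vectors `∑_{k ∈ σ} u^(k) ⊗ e_k`: the closed linear span of
the vectors `f ⊗ e_k` with `k ∈ σ`. -/
def colorSpace (σ : Set ℕ) : Submodule ℂ (L2 G) :=
  (Submodule.span ℂ {u | ∃ f : K, ∃ k ∈ σ, u = tens f (e k)}).topologicalClosure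

instance (σ : Set ℕ) : CompleteSpace (colorSpace e σ) :=
  inferInstanceAs (CompleteSpace (Submodule.topologicalClosure _))

/-- The canonical (orthogonal) projection `Π^(σ)` onto `H^(σ)`. -/
def colorProj (σ : Set ℕ) : L2 G →L[ℂ] L2 G := (colorSpace e σ).starProjection

/-- `P^(σ)`, the second quantization of `Π^(σ)`. -/
def filterProj (σ : Set ℕ) : FiniteParticle (L2 G) →ₗ[ℂ] FiniteParticle (L2 G) :=
  secondQuantization (colorProj e σ)

/-- The filtered creation operator `a^(σ)*(f ⊗ e_k) = a*(f ⊗ e_k) P^(σ)`. -/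
def filteredCreation (σ : Set ℕ) (f : K) (k : ℕ) :
    FiniteParticle (L2 G) →ₗ[ℂ] FiniteParticle (L2 G) :=
  creation (tens f (e k)) ∘ₗ filterProj e σ

/-- The filtered annihilation operator `a^(σ)(f ⊗ e_k) = P^(σ) a(f ⊗ e_k)`. -/
def filteredAnnihilation (σ : Set ℕ) (f : K) (k : ℕ) :
    FiniteParticle (L2 G) →ₗ[ℂ] FiniteParticle (L2 G) :=
  filterProj e σ ∘ₗ annihilation (tens f (e k))

end Colors

end FilteredFock

end

namespace FilteredFock

/-! ### The relation for a general one-particle space, checked on symmetric products. -/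

section SymVec

variable {H : Type*} [NormedAddCommGroup H] [InnerProductSpace ℂ H]

/-! Only two facts about the one-particle space matter: the colour projections satisfy `Π^(σ) Π^(τ)
= Π^(σ∩τ)`, and `g ⊗ e_l` is an eigenvector of `Π^(σ)` with eigenvalue 1 or 0 according to whether
`l ∈ σ`.

Write `S`, `T` for the two projections, `u`, `w` for the annihilated and created vectors, and `S w =
c w`. Since the vectors `v₁ ∘ ⋯ ∘ vₙ` span `Γ₀`, the relation can be tested on them. The first
product sends such a vector to `w ∘ Tv₁ ∘ ⋯ ∘ Tvₙ`, the square roots cancelling, then removes one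
factor against `u` and applies `S` to the rest. Removing `w` gives `⟨u, w⟩ STv₁ ∘ ⋯ ∘ STvₙ`, which
is the right-hand side. Removing `Tvⱼ` gives `⟨u, Tvⱼ⟩ Sw ∘ STv₁ ∘ ⋯` without the `j`-th factor,
which is `c` times the corresponding term of the reversed product; there `T` acts once more on the
factors `STvᵢ`, harmlessly because `TST = ST`.

This computation is `filtered_commutation`; `colorProj_comp_colorProj`, `colorProj_tens` and
`inner_tens_basis` supply its data. -/

lemma linearMap_ext_symVec {E : Type*} [AddCommGroup E] [Module ℂ E]
    {S T : FiniteParticle H →ₗ[ℂ] E} (h : ∀ (n : ℕ) (v : Fin n → H), S (symVec v) = T (symVec v)) :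
    S = T := by
  ext x
  induction x using induction_incl with
  | h0 => simp
  | h1 n x =>
    obtain ⟨x, hx⟩ := x
    induction hx using Submodule.span_induction with
    | mem x hx => obtain ⟨v, rfl⟩ := hx; exact h n v
    | zero => exact ((S ∘ₗ incl n).map_zero).trans ((T ∘ₗ incl n).map_zero).symm
    | add x y hx hy ihx ihy =>
      -- Linearity is used for `S ∘ₗ incl n`, since the span induction runs over elements packaged
      -- with their membership proofs.
      exact ((S ∘ₗ incl n).map_add ⟨x, hx⟩ ⟨y, hy⟩).trans
        ((congrArg₂ (· + ·) ihx ihy).trans ((T ∘ₗ incl n).map_add ⟨x, hx⟩ ⟨y, hy⟩).symm)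
    | smul r x hx ih =>
      exact ((S ∘ₗ incl n).map_smul r ⟨x, hx⟩).trans
        ((congrArg (r • ·) ih).trans ((T ∘ₗ incl n).map_smul r ⟨x, hx⟩).symm)
  | h2 x y hx hy => rw [map_add, map_add, hx, hy]

lemma symVec_cons_zero {n : ℕ} (v : Fin n → H) :
    symVec (Fin.cons 0 v : Fin (n + 1) → H) = 0 := by
  have h0 : symProd (Fin.cons 0 v : Fin (n + 1) → H) = 0 := by
    rw [symProd, Finset.sum_eq_zero, smul_zero]
    intro π _
    -- The permutation `π` moves the zero factor to position `π⁻¹ 0`, so every elementary tensor in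
    -- the sum vanishes.
    exact MultilinearMap.map_coord_zero _ (π.symm 0) (by simp)
  have h1 : (⟨_, symProd_mem (Fin.cons 0 v : Fin (n + 1) → H)⟩ : SymPow H (n + 1)) = 0 :=
    Subtype.ext h0
  rw [symVec, h1, map_zero]

lemma sqrt_succ_ne_zero (n : ℕ) : ((Real.sqrt (n + 1) : ℝ) : ℂ) ≠ 0 := by
  exact_mod_cast (Real.sqrt_pos.mpr (by positivity)).ne'

/-- Omitting a factor other than the newly created one commutes with prepending that one; this
matches the terms of the two operator orders. -/
lemma cons_succ_succAbove {α : Type*} {n : ℕ} (u : α) (v : Fin (n + 1) → α) (j : Fin (n + 1)) :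
    (fun i => (Fin.cons u v : Fin (n + 2) → α) (j.succ.succAbove i)) =
      (Fin.cons u (fun i => v (j.succAbove i)) : Fin (n + 1) → α) := by
  funext i
  refine Fin.cases ?_ (fun i => ?_) i <;> simp

/-- The filtered commutation relation for second quantizations of `S` and `T`, where `S T` has range
fixed by `T` and `w` is an eigenvector of `S` with eigenvalue `0` or `1`. -/
lemma filtered_commutation (S T : H →L[ℂ] H) (u w : H) (c : ℂ)
    (hT : T ∘L S ∘L T = S ∘L T) (hw : S w = c • w) (hc : c = 0 ∨ c = 1) :
    (secondQuantization S ∘ₗ annihilation u) ∘ₗ creation w ∘ₗ secondQuantization T -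
        c • ((creation w ∘ₗ secondQuantization T) ∘ₗ
          (secondQuantization S ∘ₗ annihilation u) ∘ₗ secondQuantization T) =
      (inner ℂ u w : ℂ) • secondQuantization (S ∘L T) := by
  have hT' : ∀ x, T (S (T x)) = S (T x) := fun x => DFunLike.congr_fun hT x
  refine linearMap_ext_symVec fun n v => ?_
  -- The scalar in `S w = c w` comes out of the symmetric product; with `c` equal to 0 or 1, only a
  -- zero factor needs an argument.
  have hcons : ∀ {m : ℕ} (x : Fin m → H),
      symVec (fun i => S ((Fin.cons w x : Fin (m + 1) → H) i)) =
        c • symVec (Fin.cons w (fun i => S (x i)) : Fin (m + 1) → H) := by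
    intro m x
    have : (fun i => S ((Fin.cons w x : Fin (m + 1) → H) i)) =
        Fin.cons (c • w) (fun i => S (x i)) := by
      funext i
      refine Fin.cases ?_ (fun i => ?_) i <;> simp [hw]
    rw [this]
    rcases hc with rfl | rfl
    · rw [zero_smul, zero_smul, symVec_cons_zero]
    · rw [one_smul, one_smul]
  simp only [LinearMap.sub_apply, LinearMap.smul_apply, LinearMap.comp_apply,
    secondQuantization_symVec, creation_symVec, map_smul, annihilation_symVec,
    smul_inv_smul₀ (sqrt_succ_ne_zero n), map_sum]
  -- The term `j = 0`, where `u` meets the created vector `w`, is the whole right-hand side; the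
  -- remaining terms must cancel the reversed product.
  rw [Fin.sum_univ_succ]
  simp only [Fin.cons_zero, Fin.cons_succ, Fin.succAbove_zero, ContinuousLinearMap.comp_apply]
  rw [add_sub_assoc, add_eq_left, sub_eq_zero]
  -- On the vacuum no terms remain and the reversed product vanishes, as annihilation comes before
  -- creation.
  cases n with
  | zero => simp [annihilation_vacuum]
  | succ n =>
    simp only [annihilation_symVec, map_smul, map_sum, secondQuantization_symVec, creation_symVec,
      hT', Finset.smul_sum]
    refine Finset.sum_congr rfl fun j _ => ?_
    have hj : (fun i => S ((Fin.cons w (fun i => T (v i)) : Fin (n + 2) → H)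
        (j.succ.succAbove i))) =
        fun i => S ((Fin.cons w (fun i => T (v (j.succAbove i))) : Fin (n + 1) → H) i) :=
      funext fun i => congrArg S (congrFun (cons_succ_succAbove w (fun i => T (v i)) j) i)
    rw [hj, hcons, smul_comm (inner ℂ u (T (v j)) : ℂ) ((Real.sqrt (n + 1) : ℝ) : ℂ),
      inv_smul_smul₀ (sqrt_succ_ne_zero n), smul_comm c]

end SymVec

/-! ### Colour subspaces of `L²(ℝ⁺, G)` and their projections. -/

section ColorProjections

open MeasureTheory

variable {G : Type*} [NormedAddCommGroup G] [InnerProductSpace ℂ G]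

lemma inner_tens (f g : K) (z w : G) :
    (inner ℂ (tens f z) (tens g w) : ℂ) = inner ℂ z w * inner ℂ f g := by
  rw [L2.inner_def, L2.inner_def, ← integral_const_mul]
  refine integral_congr_ae ?_
  filter_upwards [(ContinuousLinearMap.toSpanSingleton ℂ z).coeFn_compLp f,
    (ContinuousLinearMap.toSpanSingleton ℂ w).coeFn_compLp g] with t hf hg
  simp only [tens, hf, hg, ContinuousLinearMap.toSpanSingleton_apply, inner_smul_left,
    inner_smul_right, RCLike.inner_apply]
  ring

variable (e : HilbertBasis ℕ ℂ G)

lemma inner_tens_basis (f g : K) (k l : ℕ) :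
    (inner ℂ (tens f (e k)) (tens g (e l)) : ℂ) = (if k = l then 1 else 0) * inner ℂ f g := by
  rw [inner_tens, orthonormal_iff_ite.mp e.orthonormal]

lemma colorSpace_mono {σ τ : Set ℕ} (h : σ ⊆ τ) : colorSpace e σ ≤ colorSpace e τ :=
  Submodule.topologicalClosure_mono
    (Submodule.span_mono fun _ ⟨f, k, hk, hx⟩ => ⟨f, k, h hk, hx⟩)

lemma tens_mem_colorSpace {σ : Set ℕ} (f : K) {k : ℕ} (hk : k ∈ σ) :
    tens f (e k) ∈ colorSpace e σ :=
  Submodule.le_topologicalClosure _ (Submodule.subset_span ⟨f, k, hk, rfl⟩)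

/-- Passing to the closure does not change the orthogonal complement, so orthogonality to the
generators `g ⊗ e_l` with `l ∈ σ` suffices. -/
lemma tens_mem_colorSpace_orthogonal {σ : Set ℕ} (f : K) {k : ℕ} (hk : k ∉ σ) :
    tens f (e k) ∈ (colorSpace e σ)ᗮ := by
  rw [colorSpace, Submodule.orthogonal_closure, Submodule.mem_orthogonal]
  intro x hx
  induction hx using Submodule.span_induction with
  | mem x hx =>
    obtain ⟨g, l, hl, rfl⟩ := hx
    rw [inner_tens_basis, if_neg (fun h : l = k => hk (h ▸ hl)), zero_mul]
  | zero => exact inner_zero_left _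
  | add x y _ _ hx hy => rw [inner_add_left, hx, hy, add_zero]
  | smul r x _ hx => rw [inner_smul_left, hx, mul_zero]

variable [CompleteSpace G]

open scoped Classical in
-- This indicator becomes the eigenvalue `c` in `filtered_commutation`.
lemma colorProj_tens (σ : Set ℕ) (f : K) (k : ℕ) :
    colorProj e σ (tens f (e k)) = (if k ∈ σ then (1 : ℂ) else 0) • tens f (e k) := by
  split_ifs with hk
  · rw [one_smul]
    exact Submodule.starProjection_eq_self_iff.mpr (tens_mem_colorSpace e f hk)
  · rw [zero_smul]
    exact (Submodule.starProjection_apply_eq_zero_iff _).mpr (tens_mem_colorSpace_orthogonal e f hk)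

/-- Both projections are continuous, so they agree on a closed subspace; it contains each `f ⊗ e_k`
with `k ∈ τ`, because for such `k` membership in `σ` and in `σ ∩ τ` coincide. -/
lemma colorProj_eq_of_mem (σ : Set ℕ) {τ : Set ℕ} {x : L2 G} (hx : x ∈ colorSpace e τ) :
    colorProj e σ x = colorProj e (σ ∩ τ) x := by
  suffices h : colorSpace e τ ≤ LinearMap.eqLocus (colorProj e σ).toLinearMap
      (colorProj e (σ ∩ τ)).toLinearMap from h hx
  refine Submodule.topologicalClosure_minimal _ (Submodule.span_le.mpr ?_)
    (isClosed_eq (colorProj e σ).continuous (colorProj e (σ ∩ τ)).continuous)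
  rintro _ ⟨f, k, hk, rfl⟩
  classical
  simp [colorProj_tens, hk]

/-- After `Π^(τ)`, `Π^(σ)` may be replaced by `Π^(σ∩τ)`, which then absorbs `Π^(τ)` because its
range lies in `H^(τ)`. -/
lemma colorProj_comp_colorProj (σ τ : Set ℕ) :
    colorProj e σ ∘L colorProj e τ = colorProj e (σ ∩ τ) := by
  ext1 x
  rw [ContinuousLinearMap.comp_apply,
    colorProj_eq_of_mem e σ (τ := τ) (x := colorProj e τ x)
      (Submodule.starProjection_apply_mem _ x)]
  exact DFunLike.congr_fun (Submodule.starProjection_comp_starProjection_of_le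
    (colorSpace_mono e Set.inter_subset_right)) x

end ColorProjections

end FilteredFock

open FilteredFock in
open scoped Classical in
theorem lemma6p2 {G : Type*} [NormedAddCommGroup G] [InnerProductSpace ℂ G] [CompleteSpace G]
    (e : HilbertBasis ℕ ℂ G) (k l : ℕ) (σ τ : Set ℕ) (f g : K) :
    filteredAnnihilation e σ f k ∘ₗ filteredCreation e τ g l -
        (if l ∈ σ then (1 : ℂ) else 0) •
          (filteredCreation e τ g l ∘ₗ filteredAnnihilation e σ f k ∘ₗ filterProj e τ) =
      ((if k = l then (1 : ℂ) else 0) * inner ℂ f g) • filterProj e (σ ∩ τ) := by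
  -- Both sides are `Π^(σ∩τ)`, since `τ ∩ (σ ∩ τ) = σ ∩ τ`.
  have hT : colorProj e τ ∘L colorProj e σ ∘L colorProj e τ = colorProj e σ ∘L colorProj e τ := by
    rw [colorProj_comp_colorProj, colorProj_comp_colorProj, Set.inter_comm, Set.inter_assoc,
      Set.inter_self]
  have h := filtered_commutation (colorProj e σ) (colorProj e τ) (tens f (e k)) (tens g (e l))
    (if l ∈ σ then 1 else 0) hT (colorProj_tens e σ g l) (by split_ifs <;> simp)
  rw [colorProj_comp_colorProj, inner_tens_basis] at h
  exact h
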